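/- \textbf{Theorem (Inconsistent invariant variable selection for the Transfer Lasso).} Let $p$ be fixed, let $\beta^*\in\mathbb{R}^p$ have non-empty support $S=\{j:\beta^*_j\ne 0\}$, and let $\sigma>0$. For each $n$ let $y=X\beta^*+\varepsilon$, where $X\in\mathbb{R}^{n\times p}$ is a deterministic design with rows $x_1,\dots,x_n$ and the entries of $\varepsilon\in\mathbb{R}^n$ are i.i.d. $\mathcal{N}(0,\sigma^2)$. Suppose that $$\frac1n X^\top X\to C\succ O,\qquad \frac1n\max_i\|x_i\|_2^2\to 0\qquad(n\to\infty).$$ Let $m=m(n)$ be integers, positive for all large $n$, with $n/m\to r_0$ for some $r_0\in[0,\infty)$, and let $\tilde\beta$ be an initial estimator of $\beta^*$, independent of $\varepsilon$, such that $\sqrt m(\tilde\beta-\beta^*)$ converges in distribution to some random vector $z$ (so that $\tilde\beta$ is $\sqrt m$-consistent). Suppose that $\tilde\beta$ is inconsistent with respect to active variable selection, that is, $\limsup_{n\to\infty}P(\{j:\tilde\beta_j\neq0\}=S)\le c'<1$ for some constant $c'$. Let $\hat\beta_n^{\mathcal T}$ be a Transfer Lasso estimator, $$\hat\beta_n^{\mathcal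 T}\in\operatorname*{argmin}_\beta\Big\{\frac1n\|y-X\beta\|_2^2+\frac{\lambda_n}{n}\sum_j|\beta_j|+\frac{\eta_n}{n}\sum_j|\beta_j-\tilde\beta_j|\Big\},$$ where $\lambda_n/\sqrt n\to\lambda_0$ and $\eta_n/\sqrt n\to\eta_0$ for some $\lambda_0,\eta_0\in[0,\infty)$. Then the Transfer Lasso yields inconsistent invariant variable selection: there is a constant $c$ with $$\limsup_{n\to\infty}P\big(\hat\beta^{\mathcal T}_{n,S}=\tilde\beta_S\big)\le c<1,$$ where $v_S=(v_j)_{j\in S}$ is the restriction of $v$ to $S$. -/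

import Mathlib

/-!
Let `w = (XᵀX)⁻¹ eⱼ` for an active coordinate `j`, so that `(X w) ⬝ᵥ (X u) = uⱼ` for every `u`.
Perturbing a Transfer Lasso estimate in the direction `w` changes the penalty at most linearly, so
its residual satisfies `2 |(X w) ⬝ᵥ (y - X βhat)| ≤ (|lam| + |eta|) ‖w‖₁`. On the event
`βhatⱼ = βinitⱼ` this inner product is `T - (βinitⱼ - βstarⱼ)`, where `T = (X w) ⬝ᵥ ε ∼ N(0, σ² wⱼ)`
is independent of `βinit`. Conditionally on `βinit`, the centred Gaussian variable `T` thus lies in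
an interval whose half-width, in standard deviations, is `(|lam| + |eta|) ‖w‖₁ / (2 σ √wⱼ)`. Since
`‖w‖₁ / √wⱼ` is of order `1 / √n`, the half-width stays bounded when `lam` and `eta` are `O(√n)`,
and the probability of the event stays away from `1`.
-/

open Filter Topology MeasureTheory ProbabilityTheory
open scoped ENNReal NNReal Matrix

/-- The Transfer Lasso objective
`(1/n) ‖y - X β‖₂² + (lam/n) ∑ⱼ |βⱼ| + (eta/n) ∑ⱼ |βⱼ - βinitⱼ|`. -/
noncomputable def transferLassoObjective {n p : ℕ} (X : Matrix (Fin n) (Fin p) ℝ)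
    (y : Fin n → ℝ) (βinit : Fin p → ℝ) (lam eta : ℝ) (β : Fin p → ℝ) : ℝ :=
  1 / (n : ℝ) * ∑ i, (y i - (X *ᵥ β) i) ^ 2
    + lam / (n : ℝ) * ∑ j, |β j|
    + eta / (n : ℝ) * ∑ j, |β j - βinit j|

/-- `βhat` is a Transfer Lasso estimate: a global minimizer of the Transfer Lasso objective. -/
def IsTransferLasso {n p : ℕ} (X : Matrix (Fin n) (Fin p) ℝ)
    (y : Fin n → ℝ) (βinit : Fin p → ℝ) (lam eta : ℝ) (βhat : Fin p → ℝ) : Prop :=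
  IsMinOn (transferLassoObjective X y βinit lam eta) Set.univ βhat

/-- Inconsistent active variable selection of a sequence of estimators `b n` of `βstar`:
`limsup P(supp (b n) = supp βstar) ≤ c < 1` for some constant `c`. -/
def InconsistentActiveSelection {p : ℕ} {Ω : ℕ → Type*} [∀ n, MeasurableSpace (Ω n)]
    (P : ∀ n, Measure (Ω n)) (b : ∀ n, Ω n → Fin p → ℝ) (βstar : Fin p → ℝ) : Prop :=
  ∃ c : ℝ≥0∞, c < 1 ∧
    limsup (fun n => P n {ω | {j | b n ω j ≠ 0} = {j | βstar j ≠ 0}}) atTop ≤ c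

/-- Inconsistent invariant variable selection of a sequence of estimators `bhat n` of `βstar` with
initial estimators `binit n`: with `S = supp βstar`,
`limsup P((bhat n)_S = (binit n)_S) ≤ c < 1` for some constant `c`. -/
def InconsistentInvariantSelection {p : ℕ} {Ω : ℕ → Type*} [∀ n, MeasurableSpace (Ω n)]
    (P : ∀ n, Measure (Ω n)) (bhat binit : ∀ n, Ω n → Fin p → ℝ) (βstar : Fin p → ℝ) : Prop :=
  ∃ c : ℝ≥0∞, c < 1 ∧
    limsup (fun n => P n {ω | ∀ j, βstar j ≠ 0 → bhat n ω j = binit n ω j}) atTop ≤ c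

section Penalty

variable {ι κ : Type*} [Fintype ι] [Fintype κ]

theorem abs_le_of_forall_mul_le_sq_mul_add_abs_mul {g q K : ℝ}
    (h : ∀ t : ℝ, t * g ≤ t ^ 2 * q + |t| * K) : |g| ≤ K := by
  have hlim : Tendsto (fun t : ℝ => t * q + K) (𝓝[>] 0) (𝓝 K) :=
    tendsto_nhdsWithin_of_tendsto_nhds (Continuous.tendsto' (by fun_prop) _ _ (by simp))
  refine abs_le'.2 ⟨ge_of_tendsto hlim ?_, ge_of_tendsto hlim ?_⟩ <;>
    filter_upwards [self_mem_nhdsWithin] with t (ht : 0 < t)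
  · have hpos := h t
    rw [abs_of_pos ht] at hpos
    exact le_of_mul_le_mul_left (by linarith) ht
  · have hneg := h (-t)
    rw [abs_neg, abs_of_pos ht] at hneg
    exact le_of_mul_le_mul_left (by linarith) ht

theorem two_mul_abs_dotProduct_residual_le_of_forall_le {X : Matrix ι κ ℝ} {y : ι → ℝ}
    {penalty : (κ → ℝ) → ℝ} {βhat w : κ → ℝ} {K : ℝ}
    (hmin : ∀ β, (y - X *ᵥ βhat) ⬝ᵥ (y - X *ᵥ βhat) + penalty βhat
      ≤ (y - X *ᵥ β) ⬝ᵥ (y - X *ᵥ β) + penalty β)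
    (hpenalty : ∀ t : ℝ, penalty (βhat + t • w) - penalty βhat ≤ |t| * K) :
    2 * |(X *ᵥ w) ⬝ᵥ (y - X *ᵥ βhat)| ≤ K := by
  rw [← abs_two, ← abs_mul]
  refine abs_le_of_forall_mul_le_sq_mul_add_abs_mul (q := (X *ᵥ w) ⬝ᵥ (X *ᵥ w)) fun t => ?_
  have hresidual : y - X *ᵥ (βhat + t • w) = (y - X *ᵥ βhat) - t • (X *ᵥ w) := by
    rw [Matrix.mulVec_add, Matrix.mulVec_smul, sub_sub]
  have hperturb := hmin (βhat + t • w)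
  rw [hresidual] at hperturb
  simp only [sub_dotProduct (_ - _) (t • _), dotProduct_sub _ (_ - _) (t • _), smul_dotProduct,
    dotProduct_smul, smul_eq_mul, dotProduct_comm (y - X *ᵥ βhat) (X *ᵥ w)] at hperturb
  linarith [hpenalty t]

theorem abs_sum_abs_add_sub_sum_abs_le (u v : κ → ℝ) :
    |(∑ k, |u k + v k|) - (∑ k, |u k|)| ≤ ∑ k, |v k| := by
  rw [← Finset.sum_sub_distrib]
  refine (Finset.abs_sum_le_sum_abs _ _).trans (Finset.sum_le_sum fun k _ => ?_)
  simpa using abs_abs_sub_abs_le_abs_sub (u k + v k) (u k)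

/-- The penalty of the Transfer Lasso, without the factor `1 / n`. -/
noncomputable def transferPenalty (lam eta : ℝ) (βinit β : κ → ℝ) : ℝ :=
  lam * ∑ k, |β k| + eta * ∑ k, |β k - βinit k|

theorem transferPenalty_add_smul_sub_le (lam eta : ℝ) (βinit β w : κ → ℝ) (t : ℝ) :
    transferPenalty lam eta βinit (β + t • w) - transferPenalty lam eta βinit β
      ≤ |t| * ((|lam| + |eta|) * ∑ k, |w k|) := by
  have hterm (c : ℝ) (b : κ → ℝ) :
      c * (∑ k, |b k + t * w k| - ∑ k, |b k|) ≤ |c| * (|t| * ∑ k, |w k|) := by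
    refine (le_abs_self _).trans ?_
    rw [abs_mul, Finset.mul_sum]
    simp only [← abs_mul t]
    gcongr
    exact abs_sum_abs_add_sub_sum_abs_le b (fun k => t * w k)
  have hlasso := hterm lam β
  have htransfer := hterm eta (β - βinit)
  simp only [transferPenalty, Pi.add_apply, Pi.sub_apply, Pi.smul_apply, smul_eq_mul,
    add_sub_right_comm] at hlasso htransfer ⊢
  linarith

theorem natCast_mul_transferLassoObjective {n p : ℕ} (hn : n ≠ 0) (X : Matrix (Fin n) (Fin p) ℝ)
    (y : Fin n → ℝ) (βinit : Fin p → ℝ) (lam eta : ℝ) (β : Fin p → ℝ) :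
    n * transferLassoObjective X y βinit lam eta β
      = (y - X *ᵥ β) ⬝ᵥ (y - X *ᵥ β) + transferPenalty lam eta βinit β := by
  simp only [transferLassoObjective, transferPenalty, dotProduct, Pi.sub_apply, ← sq]
  field_simp
  ring

theorem IsTransferLasso.two_mul_abs_dotProduct_residual_le {n p : ℕ}
    {X : Matrix (Fin n) (Fin p) ℝ} {y : Fin n → ℝ} {βinit : Fin p → ℝ} {lam eta : ℝ}
    {βhat : Fin p → ℝ} (h : IsTransferLasso X y βinit lam eta βhat) (w : Fin p → ℝ) :
    2 * |(X *ᵥ w) ⬝ᵥ (y - X *ᵥ βhat)| ≤ (|lam| + |eta|) * ∑ k, |w k| := by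
  obtain rfl | hn := eq_or_ne n 0
  · simp only [dotProduct, Finset.univ_eq_empty, Finset.sum_empty, abs_zero, mul_zero]
    positivity
  refine two_mul_abs_dotProduct_residual_le_of_forall_le (fun β => ?_)
    (transferPenalty_add_smul_sub_le lam eta βinit βhat w)
  simp only [← natCast_mul_transferLassoObjective hn]
  exact mul_le_mul_of_nonneg_left (h (Set.mem_univ β)) n.cast_nonneg

end Penalty

section AntiConcentration

variable {Ω : Type*} [MeasurableSpace Ω] {P : Measure Ω}

theorem measure_dist_le_le_of_indepFun {E : Type*} [PseudoMetricSpace E] [MeasurableSpace E]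
    [SecondCountableTopology E] [OpensMeasurableSpace E] [IsProbabilityMeasure P] {U T : Ω → E}
    {μ : Measure E} (hindep : IndepFun U T P) (hU : AEMeasurable U P) (hT : HasLaw T μ P)
    {K : ℝ} {c : ℝ≥0∞} (hc : ∀ x, μ (Metric.closedBall x K) ≤ c) :
    P {ω | dist (T ω) (U ω) ≤ K} ≤ c := by
  have := hT.isProbabilityMeasure_iff.1 ‹_›
  have := Measure.isProbabilityMeasure_map hU
  have hmeas : MeasurableSet {x : E × E | dist x.2 x.1 ≤ K} :=
    measurableSet_le (by fun_prop) measurable_const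
  calc P {ω | dist (T ω) (U ω) ≤ K}
      = P.map (fun ω => (U ω, T ω)) {x | dist x.2 x.1 ≤ K} :=
        (Measure.map_apply_of_aemeasurable (hU.prodMk hT.aemeasurable) hmeas).symm
    _ = ∫⁻ x, μ (Metric.closedBall x K) ∂P.map U := by
        rw [hindep.map_prod_eq_prod_map_map hU hT.aemeasurable, hT.map_eq,
          Measure.prod_apply hmeas]
        rfl
    _ ≤ ∫⁻ _, c ∂P.map U := lintegral_mono hc
    _ = c := by simp

theorem measure_closedBall_le_measure_Iic {μ : Measure ℝ} [μ.IsNegInvariant] (x K : ℝ) :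
    μ (Metric.closedBall x K) ≤ μ (Set.Iic K) := by
  rw [Real.closedBall_eq_Icc]
  rcases le_total x 0 with hx | hx
  · exact measure_mono fun u hu => by simp only [Set.mem_Iic]; linarith [hu.2]
  · rw [← Measure.measure_preimage_neg μ (Set.Iic K)]
    exact measure_mono fun u hu => by
      simp only [Set.mem_preimage, Set.mem_Iic]
      linarith [hu.1]

instance isNegInvariant_gaussianReal_zero (v : ℝ≥0) : (gaussianReal 0 v).IsNegInvariant where
  neg_eq_self := gaussianReal_map_neg.trans (by rw [neg_zero])

theorem gaussianReal_zero_Iic {v : ℝ≥0} (hv : 0 < v) (K : ℝ) :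
    gaussianReal 0 v (Set.Iic K) = gaussianReal 0 1 (Set.Iic (K / √v)) := by
  have hsqrt : 0 < √(v : ℝ) := Real.sqrt_pos.2 hv
  have hscale : (gaussianReal 0 1).map (√(v : ℝ) * ·) = gaussianReal 0 v := by
    rw [gaussianReal_map_const_mul, mul_zero, mul_one]
    congr 1
    exact NNReal.eq (Real.sq_sqrt v.coe_nonneg)
  rw [← hscale, Measure.map_apply (measurable_const_mul _) measurableSet_Iic]
  congr 1
  ext x
  simp only [Set.mem_preimage, Set.mem_Iic, le_div_iff₀' hsqrt]

theorem gaussianReal_Iic_lt_one (m : ℝ) {v : ℝ≥0} (hv : v ≠ 0) (K : ℝ) :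
    gaussianReal m v (Set.Iic K) < 1 := by
  have := (gaussianReal_absolutelyContinuous' m hv).isOpenPosMeasure
  refine prob_le_one.lt_of_ne fun h => ?_
  rw [← prob_compl_eq_zero_iff measurableSet_Iic, Set.compl_Iic] at h
  exact (isOpen_Ioi.measure_pos (gaussianReal m v) Set.nonempty_Ioi).ne' h

theorem hasLaw_dotProduct_gaussianReal {ι : Type*} [Fintype ι] {ε : Ω → ι → ℝ} {m : ι → ℝ}
    {v : ι → ℝ≥0} (hlaw : ∀ i, HasLaw (fun ω => ε ω i) (gaussianReal (m i) (v i)) P)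
    (hindep : iIndepFun (fun i ω => ε ω i) P) (a : ι → ℝ) :
    HasLaw (fun ω => a ⬝ᵥ ε ω)
      (gaussianReal (a ⬝ᵥ m) (∑ i, a i ^ 2 * (v i : ℝ)).toNNReal) P := by
  have := hindep.isProbabilityMeasure
  have hterm (i : ι) := gaussianReal_const_mul (hlaw i) (a i)
  have hgauss (i : ι) : HasGaussianLaw (fun ω => a i * ε ω i) P := ⟨by
    rw [(hterm i).map_eq]
    infer_instance⟩
  have hindep' : iIndepFun (fun i ω => a i * ε ω i) P :=
    hindep.comp (fun i x => a i * x) fun i => measurable_const_mul _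
  have hmean : P[fun ω => a ⬝ᵥ ε ω] = a ⬝ᵥ m := by
    simp only [dotProduct]
    rw [integral_finsetSum _ fun i _ => (hgauss i).integrable]
    exact Finset.sum_congr rfl fun i _ => by rw [(hterm i).integral_eq, integral_id_gaussianReal]
  have hvar : Var[fun ω => a ⬝ᵥ ε ω; P] = ∑ i, a i ^ 2 * (v i : ℝ) := by
    have hsum : (fun ω => a ⬝ᵥ ε ω) = ∑ i, fun ω => a i * ε ω i := by
      ext ω
      simp [dotProduct]
    rw [hsum, IndepFun.variance_sum (fun i _ => (hgauss i).memLp_two)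
      fun i _ k _ hik => hindep'.indepFun hik]
    exact Finset.sum_congr rfl fun i _ => by
      rw [(hterm i).variance_eq, variance_id_gaussianReal, NNReal.coe_mul, NNReal.coe_mk]
  have hgauss_sum : HasGaussianLaw (fun ω => a ⬝ᵥ ε ω) P := hindep'.hasGaussianLaw_fun_sum hgauss
  exact ⟨hgauss_sum.aemeasurable, by rw [hgauss_sum.map_eq_gaussianReal, hmean, hvar]⟩

end AntiConcentration

section InverseGram

variable {ι κ : Type*} [Fintype ι] [Fintype κ] [DecidableEq κ]

theorem dotProduct_mulVec_col_inv_gram {R : Type*} [CommRing R] {X : Matrix ι κ R}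
    (hX : IsUnit (Xᵀ * X).det) (j : κ) (u : κ → R) :
    (X *ᵥ (Xᵀ * X)⁻¹.col j) ⬝ᵥ (X *ᵥ u) = u j := by
  rw [dotProduct_comm, Matrix.dotProduct_mulVec, Matrix.vecMul_mulVec, ← Matrix.dotProduct_mulVec,
    ← Matrix.mulVec_single_one, Matrix.mulVec_mulVec, Matrix.mul_nonsing_inv _ hX,
    Matrix.one_mulVec, dotProduct_single_one]

theorem inv_gram_diag_pos {X : Matrix ι κ ℝ} (hX : IsUnit (Xᵀ * X).det) (j : κ) :
    0 < (Xᵀ * X)⁻¹ j j := by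
  have hpsd := Matrix.posSemidef_conjTranspose_mul_self X
  rw [Matrix.conjTranspose_eq_transpose_of_trivial] at hpsd
  exact (hpsd.posDef_iff_isUnit.2 ((Matrix.isUnit_iff_isUnit_det _).2 hX)).inv.diag_pos

theorem hasLaw_dotProduct_mulVec_col_inv_gram {Ω : Type*} [MeasurableSpace Ω] {P : Measure Ω}
    {X : Matrix ι κ ℝ} (hX : IsUnit (Xᵀ * X).det) {v : ℝ≥0} {ε : Ω → ι → ℝ}
    (hεlaw : ∀ i, HasLaw (fun ω => ε ω i) (gaussianReal 0 v) P)
    (hεindep : iIndepFun (fun i ω => ε ω i) P) (j : κ) :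
    HasLaw (fun ω => (X *ᵥ (Xᵀ * X)⁻¹.col j) ⬝ᵥ ε ω)
      (gaussianReal 0 ((Xᵀ * X)⁻¹ j j * v).toNNReal) P := by
  have h := hasLaw_dotProduct_gaussianReal (m := 0) hεlaw hεindep (X *ᵥ (Xᵀ * X)⁻¹.col j)
  simp only [sq (Matrix.mulVec _ _ _), ← Finset.sum_mul] at h
  rwa [dotProduct_zero, ← dotProduct, dotProduct_mulVec_col_inv_gram hX] at h

/-- For `w = A⁻¹ eⱼ`, the ratio of the `ℓ¹` norm of `w` to `√(wᵀ A w) = √wⱼ`. When `A` is the Gram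
matrix of a design, it converts the size of the penalty into standard deviations of the noise in
the direction `w`. -/
noncomputable def invColRatio (A : Matrix κ κ ℝ) (j : κ) : ℝ :=
  (∑ k, |A⁻¹ k j|) / √(A⁻¹ j j)

theorem invColRatio_smul {A : Matrix κ κ ℝ} (hA : IsUnit A.det) {c : ℝ} (hc : 0 < c) (j : κ) :
    invColRatio (c • A) j = invColRatio A j / √c := by
  have hinv : (c • A)⁻¹ = c⁻¹ • A⁻¹ := A.inv_smul' (Units.mk0 c hc.ne') hA
  simp only [invColRatio, hinv, Matrix.smul_apply, smul_eq_mul, abs_mul, ← Finset.mul_sum,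
    Real.sqrt_mul (inv_nonneg.2 hc.le), abs_of_pos (inv_pos.2 hc), Real.sqrt_inv]
  nth_rw 1 [← Real.mul_self_sqrt hc.le]
  field_simp

theorem continuousAt_invColRatio {A : Matrix κ κ ℝ} (hA : A.PosDef) (j : κ) :
    ContinuousAt (invColRatio · j) A := by
  have hinv : ContinuousAt Inv.inv A := continuousAt_matrix_inv A <| by
    simpa using NormedRing.inverse_continuousAt (Units.mk0 _ hA.det_pos.ne')
  have hentry (k : κ) : ContinuousAt (fun B : Matrix κ κ ℝ => B⁻¹ k j) A :=
    (continuous_apply_apply k j).continuousAt.comp hinv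
  exact (tendsto_finsetSum _ fun k _ => (hentry k).abs).div (hentry j).sqrt
    (Real.sqrt_pos.2 hA.inv.diag_pos).ne'

theorem eventually_isUnit_det_of_tendsto_smul {𝕜 α : Type*} [Field 𝕜] [TopologicalSpace 𝕜]
    [IsTopologicalRing 𝕜] [T1Space 𝕜] {l : Filter α} {c : α → 𝕜} {A : α → Matrix κ κ 𝕜}
    {C : Matrix κ κ 𝕜} (hC : C.det ≠ 0) (hA : Tendsto (fun n => c n • A n) l (𝓝 C)) :
    ∀ᶠ n in l, IsUnit (A n).det := by
  filter_upwards [((continuous_id.matrix_det.tendsto C).comp hA).eventually_ne hC] with n hn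
  rw [Function.comp_apply, id_eq, Matrix.det_smul] at hn
  exact (right_ne_zero_of_mul hn).isUnit

theorem isBigO_invColRatio_of_tendsto_smul {α : Type*} {l : Filter α} {c : α → ℝ}
    {A : α → Matrix κ κ ℝ} {C : Matrix κ κ ℝ} (hC : C.PosDef) (hc : ∀ᶠ n in l, 0 < c n)
    (hA : Tendsto (fun n => c n • A n) l (𝓝 C)) (j : κ) :
    (fun n => invColRatio (A n) j) =O[l] fun n => √(c n) := by
  have hlim := (continuousAt_invColRatio hC j).tendsto.comp hA
  refine ((hlim.isBigO_one ℝ).mul (Asymptotics.isBigO_refl (fun n => √(c n)) l)).congr' ?_ (by simp)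
  filter_upwards [eventually_isUnit_det_of_tendsto_smul hC.det_pos.ne' hA, hc] with n hunit hcn
  rw [Function.comp_apply, invColRatio_smul hunit hcn,
    div_mul_cancel₀ _ (Real.sqrt_pos.2 hcn).ne']

end InverseGram

theorem IsTransferLasso.dist_le_of_apply_eq_init {n p : ℕ} {X : Matrix (Fin n) (Fin p) ℝ}
    (hX : IsUnit (Xᵀ * X).det) {βstar βinit βhat : Fin p → ℝ} {e : Fin n → ℝ} {lam eta : ℝ}
    (h : IsTransferLasso X (X *ᵥ βstar + e) βinit lam eta βhat) {j : Fin p}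
    (hj : βhat j = βinit j) :
    dist ((X *ᵥ (Xᵀ * X)⁻¹.col j) ⬝ᵥ e) (βinit j - βstar j)
      ≤ (|lam| + |eta|) * (∑ k, |(Xᵀ * X)⁻¹ k j|) / 2 := by
  have hband := h.two_mul_abs_dotProduct_residual_le ((Xᵀ * X)⁻¹.col j)
  rw [add_sub_right_comm, ← Matrix.mulVec_sub, dotProduct_add, dotProduct_mulVec_col_inv_gram hX,
    Pi.sub_apply, hj, ← neg_sub (βinit j), ← sub_eq_neg_add] at hband
  rwa [Real.dist_eq, le_div_iff₀' two_pos]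

theorem IsTransferLasso.measure_apply_eq_init_le {n p : ℕ} {Ω : Type*} [MeasurableSpace Ω]
    {P : Measure Ω} {X : Matrix (Fin n) (Fin p) ℝ} (hX : IsUnit (Xᵀ * X).det)
    {βstar : Fin p → ℝ} {σ : ℝ≥0} (hσ : 0 < σ) {ε : Ω → Fin n → ℝ}
    (hεlaw : ∀ i, HasLaw (fun ω => ε ω i) (gaussianReal 0 (σ ^ 2)) P)
    (hεindep : iIndepFun (fun i ω => ε ω i) P) {βinit : Ω → Fin p → ℝ}
    (hβinit : AEMeasurable βinit P) (hindep : IndepFun βinit ε P) {lam eta : ℝ}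
    {βhat : Ω → Fin p → ℝ}
    (hβhat : ∀ ω, IsTransferLasso X (X *ᵥ βstar + ε ω) (βinit ω) lam eta (βhat ω)) (j : Fin p) :
    P {ω | βhat ω j = βinit ω j} ≤ gaussianReal 0 1
      (Set.Iic ((|lam| + |eta|) / (2 * σ) * invColRatio (Xᵀ * X) j)) := by
  have := hεindep.isProbabilityMeasure
  set K := (|lam| + |eta|) * (∑ k, |(Xᵀ * X)⁻¹ k j|) / 2 with hK
  set T : (Fin n → ℝ) → ℝ := fun e => (X *ᵥ (Xᵀ * X)⁻¹.col j) ⬝ᵥ e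
  have hTmeas : Measurable T := by
    unfold T dotProduct
    fun_prop
  have hw := inv_gram_diag_pos hX j
  calc P {ω | βhat ω j = βinit ω j}
      ≤ P {ω | dist (T (ε ω)) (βinit ω j - βstar j) ≤ K} :=
        measure_mono fun ω hω => (hβhat ω).dist_le_of_apply_eq_init hX hω
    _ ≤ gaussianReal 0 ((Xᵀ * X)⁻¹ j j * (σ ^ 2 : ℝ≥0)).toNNReal (Set.Iic K) :=
        measure_dist_le_le_of_indepFun
          (hindep.comp (φ := fun b : Fin p → ℝ => b j - βstar j) (by fun_prop) hTmeas)
          (by fun_prop) (hasLaw_dotProduct_mulVec_col_inv_gram hX hεlaw hεindep j)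
          fun x => measure_closedBall_le_measure_Iic x K
    _ = _ := by
        rw [gaussianReal_zero_Iic (Real.toNNReal_pos.2 (by positivity)),
          Real.coe_toNNReal _ (by positivity), Real.sqrt_mul hw.le, NNReal.coe_pow,
          Real.sqrt_sq σ.coe_nonneg]
        congr 2
        simp only [hK, invColRatio]
        field_simp

theorem inconsistentInvariantSelection_of_limsup_lt_one {p : ℕ} {Ω : ℕ → Type*}
    [∀ n, MeasurableSpace (Ω n)] {P : ∀ n, Measure (Ω n)} {bhat binit : ∀ n, Ω n → Fin p → ℝ}
    {βstar : Fin p → ℝ} {j : Fin p} (hj : βstar j ≠ 0)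
    (h : limsup (fun n => P n {ω | bhat n ω j = binit n ω j}) atTop < 1) :
    InconsistentInvariantSelection P bhat binit βstar :=
  ⟨_, h, limsup_le_limsup (Eventually.of_forall fun _ => measure_mono fun _ hω => hω j hj)⟩

theorem aemeasurable_of_const_smul_sub {Ω 𝕜 E : Type*} [MeasurableSpace Ω] {P : Measure Ω}
    [DivisionRing 𝕜] [MeasurableSpace E] [AddCommGroup E] [Module 𝕜 E] [MeasurableConstSMul 𝕜 E]
    [MeasurableAdd E] {c : 𝕜} (hc : c ≠ 0) {b : Ω → E} {x : E}
    (h : AEMeasurable (fun ω => c • (b ω - x)) P) : AEMeasurable b P := by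
  simpa using ((aemeasurable_const_smul_iff₀ hc).1 h).add_const x

theorem isBigO_sqrt_of_tendsto_div {f : ℕ → ℝ} {c : ℝ}
    (h : Tendsto (fun n : ℕ => f n / √(n : ℝ)) atTop (𝓝 c)) :
    f =O[atTop] fun n => √(n : ℝ) :=
  Asymptotics.isBigO_of_div_tendsto_nhds
    ((eventually_gt_atTop 0).mono fun n hn h0 => by
      simp only [Real.sqrt_eq_zero', Nat.cast_nonpos] at h0; lia) c h

theorem mainTheorem9_general {p : ℕ} (βstar : Fin p → ℝ) (σ : ℝ≥0) (hσ : 0 < σ)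
    {Ω : ℕ → Type*} [∀ n, MeasurableSpace (Ω n)] (P : ∀ n, Measure (Ω n))
    (X : ∀ n : ℕ, Matrix (Fin n) (Fin p) ℝ) (C : Matrix (Fin p) (Fin p) ℝ) (hC : C.PosDef)
    (hXC : Tendsto (fun n : ℕ => (1 / (n : ℝ)) • ((X n)ᵀ * X n)) atTop (𝓝 C))
    (ε : ∀ n : ℕ, Ω n → Fin n → ℝ)
    (hεlaw : ∀ (n : ℕ) (i : Fin n), HasLaw (fun ω => ε n ω i) (gaussianReal 0 (σ ^ 2)) (P n))
    (hεindep : ∀ n : ℕ, iIndepFun (fun (i : Fin n) ω => ε n ω i) (P n))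
    (y : ∀ n : ℕ, Ω n → Fin n → ℝ)
    (hy : ∀ (n : ℕ) (ω : Ω n), y n ω = X n *ᵥ βstar + ε n ω)
    (βinit : ∀ n, Ω n → Fin p → ℝ) (hβinit : ∀ᶠ n in atTop, AEMeasurable (βinit n) (P n))
    (hindep : ∀ n, IndepFun (βinit n) (ε n) (P n))
    (lam eta : ℕ → ℝ) (hlam : lam =O[atTop] fun n => √(n : ℝ))
    (heta : eta =O[atTop] fun n => √(n : ℝ))
    (βhat : ∀ n, Ω n → Fin p → ℝ)
    (hβhat : ∀ (n : ℕ) (ω : Ω n),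
      IsTransferLasso (X n) (y n ω) (βinit n ω) (lam n) (eta n) (βhat n ω))
    (j : Fin p) :
    limsup (fun n => P n {ω | βhat n ω j = βinit n ω j}) atTop < 1 := by
  have hwidth : (fun n => (|lam n| + |eta n|) / (2 * σ) * invColRatio ((X n)ᵀ * X n) j)
      =O[atTop] fun _ => (1 : ℝ) := by
    have hratio := isBigO_invColRatio_of_tendsto_smul hC
      ((eventually_gt_atTop 0).mono fun n hn => one_div_pos.2 (Nat.cast_pos.2 hn)) hXC j
    refine (((hlam.norm_left.add heta.norm_left).mul hratio).const_mul_left (2 * (σ : ℝ))⁻¹).congr'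
      (Eventually.of_forall fun n => ?_) ?_
    · simp only [Real.norm_eq_abs]
      ring
    · filter_upwards [eventually_gt_atTop 0] with n hn
      have hn' : (0 : ℝ) < n := Nat.cast_pos.2 hn
      rw [← Real.sqrt_mul hn'.le, mul_one_div_cancel hn'.ne', Real.sqrt_one]
  obtain ⟨K, hK⟩ := hwidth.bound
  refine (limsup_le_of_le (h := ?_)).trans_lt (gaussianReal_Iic_lt_one 0 one_ne_zero K)
  filter_upwards [eventually_isUnit_det_of_tendsto_smul hC.det_pos.ne' hXC, hβinit, hK]
    with n hunit hmeas hKn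
  refine (IsTransferLasso.measure_apply_eq_init_le hunit hσ (hεlaw n) (hεindep n) hmeas (hindep n)
    (fun ω => hy n ω ▸ hβhat n ω) j).trans (measure_mono (Set.Iic_subset_Iic.2 ?_))
  simpa using (le_abs_self _).trans hKn

theorem mainTheorem9
    {p : ℕ}
    -- the true parameter, with at least one active variable, and the noise level
    (βstar : Fin p → ℝ) (hβstar : βstar ≠ 0)
    (σ : ℝ≥0) (hσ : 0 < σ)
    -- the probability spaces, one for each target sample size `n`
    {Ω : ℕ → Type*} [∀ n, MeasurableSpace (Ω n)]
    (P : ∀ n, Measure (Ω n)) [∀ n, IsProbabilityMeasure (P n)]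
    -- the design: `(1/n) Xᵀ X → C ≻ 0` and `(1/n) maxᵢ ‖xᵢ‖₂² → 0`
    (X : ∀ n : ℕ, Matrix (Fin n) (Fin p) ℝ)
    (C : Matrix (Fin p) (Fin p) ℝ) (hC : C.PosDef)
    (hXC : Tendsto (fun n : ℕ => (1 / (n : ℝ)) • ((X n)ᵀ * X n)) atTop (𝓝 C))
    (hXmax : Tendsto (fun n : ℕ => 1 / (n : ℝ) * ⨆ i : Fin n, ∑ j, X n i j ^ 2) atTop (𝓝 0))
    -- the i.i.d. Gaussian noise and the response of the linear model
    (ε : ∀ n : ℕ, Ω n → Fin n → ℝ)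
    (hεlaw : ∀ (n : ℕ) (i : Fin n), HasLaw (fun ω => ε n ω i) (gaussianReal 0 (σ ^ 2)) (P n))
    (hεindep : ∀ n : ℕ, iIndepFun (fun (i : Fin n) ω => ε n ω i) (P n))
    (y : ∀ n : ℕ, Ω n → Fin n → ℝ)
    (hy : ∀ (n : ℕ) (ω : Ω n), y n ω = X n *ᵥ βstar + ε n ω)
    -- the source sample sizes: `n / m → r₀ ≥ 0`
    (m : ℕ → ℕ) (hm : ∀ᶠ n in atTop, 0 < m n)
    (r₀ : ℝ) (hr₀ : 0 ≤ r₀)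
    (hmr : Tendsto (fun n : ℕ => (n : ℝ) / (m n : ℝ)) atTop (𝓝 r₀))
    -- the initial estimator, independent of the target data,
    -- with `√m (βinit - βstar)` convergent in distribution
    (βinit : ∀ n, Ω n → Fin p → ℝ)
    (hindep : ∀ n, IndepFun (βinit n) (ε n) (P n))
    {Ω' : Type*} [MeasurableSpace Ω'] (P' : Measure Ω') [IsProbabilityMeasure P']
    (z : Ω' → Fin p → ℝ)
    (hz : TendstoInDistribution
      (fun (n : ℕ) ω => √(m n : ℝ) • (βinit n ω - βstar)) atTop z P P')
    (hinit : InconsistentActiveSelection P βinit βstar)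
    -- the hyperparameters: `lam n / √n → lam₀ ≥ 0` and `eta n / √n → eta₀ ≥ 0`
    (lam eta : ℕ → ℝ) (lam₀ eta₀ : ℝ) (hlam₀ : 0 ≤ lam₀) (heta₀ : 0 ≤ eta₀)
    (hlam : Tendsto (fun n : ℕ => lam n / √(n : ℝ)) atTop (𝓝 lam₀))
    (heta : Tendsto (fun n : ℕ => eta n / √(n : ℝ)) atTop (𝓝 eta₀))
    -- the Transfer Lasso estimator
    (βhat : ∀ n, Ω n → Fin p → ℝ)
    (hβhat : ∀ (n : ℕ) (ω : Ω n),
      IsTransferLasso (X n) (y n ω) (βinit n ω) (lam n) (eta n) (βhat n ω)) :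
    InconsistentInvariantSelection P βhat βinit βstar := by
  obtain ⟨j, hj⟩ := Function.ne_iff.1 hβstar
  exact inconsistentInvariantSelection_of_limsup_lt_one hj
    (mainTheorem9_general βstar σ hσ P X C hC hXC ε hεlaw hεindep y hy βinit
      (hm.mono fun n hn => aemeasurable_of_const_smul_sub
        (Real.sqrt_ne_zero'.2 (Nat.cast_pos.2 hn)) (hz.forall_aemeasurable n)) hindep lam eta
      (isBigO_sqrt_of_tendsto_div hlam) (isBigO_sqrt_of_tendsto_div heta) βhat hβhat j)
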